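/- **Model.** A network is a connected undirected graph on $n$ nodes with diameter $D$; communication takes place in synchronous rounds, and in each round every node either listens or transmits. In a *radio network with collision detection* a transmission is a packet of a fixed number of bits; a listening node perceives silence if none of its neighbors transmits, receives the packet if exactly one neighbor transmits, and detects a collision if at least two do. In a *beep network* a transmission is a beep, and a listening node only learns whether at least one of its neighbors beeps. A transmitting node learns nothing in that round. Each node independently samples a uniform $b$-bit identifier and has an independent private random tape. All nodes run the same protocol, which may depend on $n$, $D$, $b$ and the packet length: the action and the output of a node depend only on its identifier, its tape, and what it has perceived since it woke up. Either all nodes are awake from round $0$ (synchronous wake-up), or an arbitrary nonempty set of nodes is awake initially and each other node listens until it is woken up by the first round in which it does not perceive silence (arbitrary wake-up). For $c>0$, a protocol *solves leader election for $(n,D)$ in $T$ rounds with probability at least $1-n^{-c}$* if, on every connected $n$-node network of diameter $D$ and for every allowed set of initially awake nodes, with at least this probability all nodes output after $T$ rounds one and the same identifier, which is the identifier of a node of the network. **Statement.** For every constant $c>0$ there are $\kappa>0$ and $n_0$, depending only on $c$, such that the following holds in radio networks with collision detection (with any packet length) and in beep networks, under synchronous as well as under arbitrary wake-up. Let $n\ge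 n_0$, $1\le D\le n-1$, and let $b$ be such that $n$ independent uniform $b$-bit identifiers are pairwise distinct with probability at least $1-n^{-c}$. Then every randomized protocol that solves leader election for $(n,D)$ in $T$ rounds with probability at least $1-n^{-c}$ satisfies $$T\ \ge\ \kappa\,(D+\log n).$$ That is, leader election with high probability requires $\Omega(D+\log n)$ rounds. -/

import Mathlib

open MeasureTheory

namespace RadioNetwork

/-- The two communication models: radio networks with collision detection, in which a transmission
is a packet of `packetBits` bits, and beep networks, in which a transmission is a bare beep. -/
inductive Model where
  | radioCD (packetBits : ℕ)
  | beep

/-- What one transmission can carry. A beep carries no information. -/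
def Model.Packet : Model → Type
  | .radioCD p => Fin p → Bool
  | .beep => Unit

/-- What a node perceives in one round: `own` (it transmitted itself and learns nothing), silence,
a received packet, a detected collision, or, in beep networks, a heard beep. -/
inductive Obs (M : Type) where
  | own
  | silence
  | packet (m : M)
  | collision
  | beep

open Classical in
/-- The observation of node `v` in a round of a radio network with collision detection in which
node `u` performs the action `a u` (`none`: listen, `some m`: transmit the packet `m`). -/
noncomputable def radioObs {V M : Type} (G : SimpleGraph V) (a : V → Option M) (v : V) : Obs M :=
  if (a v).isSome then .own
  else if h : ∃! u, G.Adj v u ∧ (a u).isSome then .packet ((a h.choose).get h.choose_spec.1.2)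
  else if ∃ u, G.Adj v u ∧ (a u).isSome then .collision
  else .silence

open Classical in
/-- The observation of node `v` in a round of a beep network in which node `u` beeps if and only if
`a u` is not `none`. -/
noncomputable def beepObs {V M : Type} (G : SimpleGraph V) (a : V → Option M) (v : V) : Obs M :=
  if (a v).isSome then .own
  else if ∃ u, G.Adj v u ∧ (a u).isSome then .beep
  else .silence

/-- The observation of node `v` in one round, in the given model. -/
noncomputable def Model.observe (model : Model) {V : Type} (G : SimpleGraph V)
    (a : V → Option model.Packet) (v : V) : Obs model.Packet :=
  match model with
  | .radioCD _ => radioObs G a v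
  | .beep => beepObs G a v

/-- Identifiers of `b` bits. -/
abbrev ID (b : ℕ) : Type := Fin b → Bool

/-- The uniform distribution on identifiers of `b` bits. -/
noncomputable def idLaw (b : ℕ) : Measure (ID b) := (PMF.uniformOfFintype (ID b)).toMeasure

/-- If `n` nodes independently sample uniform identifiers of `b` bits, these are pairwise distinct
with probability at least `1 - n ^ (-c)`. -/
def IDsUniqueWHP (n b : ℕ) (c : ℝ) : Prop :=
  1 - (n : ℝ) ^ (-c) ≤
    (Measure.pi fun _ : Fin n => idLaw b).real {ids | Function.Injective ids}

/-- A randomized distributed protocol, run by all nodes. Each node has a private random tape drawn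
from `law`. What it does next (`act`: listen or transmit) and what it currently outputs (`out`:
nothing yet, or an identifier) is determined by its own identifier, its own tape, and the list of
its observations since it woke up, the latest one first. -/
structure Protocol (model : Model) (b : ℕ) where
  Tape : Type
  [mTape : MeasurableSpace Tape]
  law : Measure Tape
  [prob : IsProbabilityMeasure law]
  act : ID b → Tape → List (Obs model.Packet) → Option model.Packet
  out : ID b → Tape → List (Obs model.Packet) → Option (ID b)
  measurable_act : ∀ i h a, MeasurableSet {ω | act i ω h = a}
  measurable_out : ∀ i h x, MeasurableSet {ω | out i ω h = x}

attribute [instance] Protocol.mTape Protocol.prob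

/-- Which sets of nodes may be awake in round zero: all nodes, or an arbitrary nonempty set. -/
inductive WakeUp where
  | synchronous
  | arbitrary

/-- `wake.Allows W`: the set `W` of initially awake nodes is allowed. -/
def WakeUp.Allows {V : Type} : WakeUp → Set V → Prop
  | .synchronous, W => W = Set.univ
  | .arbitrary, W => W.Nonempty

namespace Protocol

variable {model : Model} {b : ℕ}

open Classical in
/-- The observations of node `v` since it woke up, after `r` rounds in the network `G`, where the
nodes of `W` are awake initially and `s u` is the identifier and the tape of node `u`. The value is
`none` while `v` is asleep. A sleeping node listens, and is woken up by the first round in which it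
does not perceive silence. -/
noncomputable def view (P : Protocol model b) {V : Type} (G : SimpleGraph V) (W : Set V)
    (s : V → ID b × P.Tape) : ℕ → V → Option (List (Obs model.Packet))
  | 0, v => if v ∈ W then some [] else none
  | r + 1, v =>
    let o := model.observe G
      (fun u => (P.view G W s r u).bind fun h => P.act (s u).1 (s u).2 h) v
    match P.view G W s r v with
    | some h => some (o :: h)
    | none => if o = .silence then none else some [o]

/-- What node `v` outputs after `r` rounds, if anything. -/
noncomputable def output (P : Protocol model b) {V : Type} (G : SimpleGraph V) (W : Set V)
    (s : V → ID b × P.Tape) (r : ℕ) (v : V) : Option (ID b) :=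
  (P.view G W s r v).bind fun h => P.out (s v).1 (s v).2 h

/-- A leader is elected after `T` rounds: all nodes output one and the same identifier, and it is
the identifier of a node of the network. -/
def Elects (P : Protocol model b) {V : Type} (G : SimpleGraph V) (W : Set V) (T : ℕ)
    (s : V → ID b × P.Tape) : Prop :=
  ∃ x : ID b, (∃ u, (s u).1 = x) ∧ ∀ v, P.output G W s T v = some x

/-- The joint law of identifiers and tapes of `n` nodes: all of them are independent. -/
noncomputable def seedLaw (P : Protocol model b) (n : ℕ) : Measure (Fin n → ID b × P.Tape) :=
  Measure.pi fun _ => (idLaw b).prod P.law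

/-- The protocol solves leader election on `n`-node networks of diameter `D` within `T` rounds with
probability at least `1 - n ^ (-c)`: this holds for every connected network with these parameters
and every allowed set of initially awake nodes. -/
def SolvesLeaderElection (P : Protocol model b) (wake : WakeUp) (n D T : ℕ) (c : ℝ) : Prop :=
  ∀ G : SimpleGraph (Fin n), G.Connected → G.diam = D →
    ∀ W : Set (Fin n), wake.Allows W →
      1 - (n : ℝ) ^ (-c) ≤ (P.seedLaw n).real {s | P.Elects G W T s}

end Protocol

end RadioNetwork

/-! Both bounds come from one network with every node awake and from one guessing principle
(`iidProb_guess_le`). The elected identifier belongs to some node `w`, while a list of `K`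
candidates computed without the seed of `w` contains the identifier of `w` with probability at most
`K * 2 ^ (-b)`. Uniqueness of the identifiers forces `n * 2 ^ (-b) ≤ 4 * n ^ (-c)`
(`mul_inv_two_pow_le_of_unique`), so after a union bound over `w` success is unlikely whenever `K`
is small.

The network has layers `0, …, D`; nodes in equal or consecutive layers are adjacent. All spare nodes
sit in layers `0` and `1`.

Diameter: if `2 * T < D`, every `w` is more than `T` layers away from one of the two ends. The
output of that end is a single guess independent of `w` (`iidProb_elect_le_of_far`), whence `D ≤ 2 *
T`.

Logarithm: take two nodes in layer `0`. If both perceive only silence and noise while listening, the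
history of each is determined by its own seed and `T` bits. One of the two is not `w`, and it offers
`2 ^ T` guesses (`iidProb_elect_le_of_uninformed`). Beeps never carry more than this. With packets
it still happens with probability at least `16 ^ (-T)` (`iidProb_uninformed_radio`): split layers
`0` and `1` into three copies of a set `A`. If all copies used the same seeds, every transmission
there would have a twin, so no packet from these layers would get through. The record of which of
the two layers is busy in which round takes `4 ^ T` values, so three independent seed assignments
produce the same record with probability at least `(4 ^ T) ^ (-2)`. Then the real run, where each
copy has its own assignment, is indistinguishable from the duplicated runs (`run_mixed`). Altogether
`n ^ c ≤ 5 * 32 ^ T`. -/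

namespace RadioNetwork

/-! ### Finite product distributions, guessing and coincidence -/

section IID

/-- The expectation of `f` under independent choices of the coordinates of `s : V → S`, each with
the weights `p`. -/
noncomputable def iidExp {V S : Type} [Fintype V] [DecidableEq V] [Fintype S] (p : S → ℝ)
    (f : (V → S) → ℝ) : ℝ :=
  ∑ s : V → S, (∏ v, p (s v)) * f s

/-- The probability of `E` under independent choices of the coordinates with the weights `p`. -/
noncomputable def iidProb {V S : Type} [Fintype V] [DecidableEq V] [Fintype S] (p : S → ℝ)
    (E : Set (V → S)) : ℝ :=
  iidExp p (E.indicator 1)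

variable {V V' S : Type} [Fintype V] [DecidableEq V] [Fintype V'] [DecidableEq V'] [Fintype S]
  {p : S → ℝ}

theorem iidExp_const (hp : ∑ σ, p σ = 1) (a : ℝ) : iidExp (V := V) p (fun _ => a) = a := by
  have h : ∑ s : V → S, ∏ v, p (s v) = 1 := by
    rw [← Fintype.prod_sum (fun _ : V => p)]
    simp [hp]
  unfold iidExp
  rw [← Finset.sum_mul, h, one_mul]

theorem iidExp_mono (hp : ∀ σ, 0 ≤ p σ) {f g : (V → S) → ℝ} (h : ∀ s, f s ≤ g s) :
    iidExp p f ≤ iidExp p g :=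
  Finset.sum_le_sum fun s _ =>
    mul_le_mul_of_nonneg_left (h s) (Finset.prod_nonneg fun v _ => hp (s v))

theorem iidExp_add (f g : (V → S) → ℝ) :
    iidExp p (fun s => f s + g s) = iidExp p f + iidExp p g := by
  simp only [iidExp, mul_add, Finset.sum_add_distrib]

theorem iidExp_finset_sum {ι : Type} (t : Finset ι) (f : ι → (V → S) → ℝ) :
    iidExp p (fun s => ∑ i ∈ t, f i s) = ∑ i ∈ t, iidExp p (f i) := by
  simp only [iidExp, Finset.mul_sum]
  rw [Finset.sum_comm]

theorem iidProb_mono (hp : ∀ σ, 0 ≤ p σ) {E F : Set (V → S)} (h : E ⊆ F) :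
    iidProb p E ≤ iidProb p F :=
  iidExp_mono hp fun s => Set.indicator_le_indicator_of_subset h (fun _ => zero_le_one) s

theorem iidProb_union_le (hp : ∀ σ, 0 ≤ p σ) (E F : Set (V → S)) :
    iidProb p (E ∪ F) ≤ iidProb p E + iidProb p F := by
  unfold iidProb
  rw [← iidExp_add]
  refine iidExp_mono hp fun s => ?_
  by_cases hE : s ∈ E <;> by_cases hF : s ∈ F <;> simp [hE, hF]

theorem iidProb_iUnion_le {ι : Type} [Fintype ι] (hp : ∀ σ, 0 ≤ p σ) (E : ι → Set (V → S)) :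
    iidProb p (⋃ i, E i) ≤ ∑ i, iidProb p (E i) := by
  unfold iidProb
  rw [← iidExp_finset_sum]
  refine iidExp_mono hp fun s => ?_
  have h0 : ∀ i, 0 ≤ (E i).indicator (1 : (V → S) → ℝ) s := fun i =>
    Set.indicator_nonneg (fun _ _ => zero_le_one) s
  by_cases h : s ∈ ⋃ i, E i
  · obtain ⟨i, hi⟩ := Set.mem_iUnion.1 h
    rw [Set.indicator_of_mem h]
    refine le_trans ?_ (Finset.single_le_sum (fun i _ => h0 i) (Finset.mem_univ i))
    simp [hi]
  · rw [Set.indicator_of_notMem h]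
    exact Finset.sum_nonneg fun i _ => h0 i

theorem iidProb_compl (hp1 : ∑ σ, p σ = 1) (E : Set (V → S)) :
    iidProb p Eᶜ = 1 - iidProb p E := by
  have h : iidProb p E + iidProb p Eᶜ = 1 := by
    unfold iidProb
    rw [← iidExp_add, ← iidExp_const (V := V) hp1 1]
    congr 1
    funext s
    by_cases hE : s ∈ E <;> simp [hE]
  linarith

theorem iidExp_equiv (e : V ≃ V') (f : (V → S) → ℝ) :
    iidExp p f = iidExp (V := V') p (fun s => f (s ∘ e)) := by
  unfold iidExp
  refine Fintype.sum_equiv (e.arrowCongr (Equiv.refl S)) _ _ fun s => ?_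
  congr 1
  · exact Fintype.prod_equiv e _ _ fun v => by simp
  · congr 1
    funext v
    simp

theorem iidExp_sum_type (f : (V ⊕ V' → S) → ℝ) :
    iidExp p f = iidExp (V := V) p (fun s => iidExp (V := V') p fun s' => f (Sum.elim s s')) := by
  unfold iidExp
  rw [Fintype.sum_equiv (Equiv.sumArrowEquivProdArrow V V' S) _
    (fun x => ((∏ v, p (x.1 v)) * ∏ v, p (x.2 v)) * f (Sum.elim x.1 x.2)), Fintype.sum_prod_type]
  · simp only [Finset.mul_sum, mul_assoc]
  · intro s
    rw [Fintype.prod_sum_type]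
    congr 2
    funext x
    cases x <;> rfl

/-- Coordinates outside the range of `j` integrate out. This is what allows the third copy of `A` to
be incomplete. -/
theorem iidExp_comp_injective (hp1 : ∑ σ, p σ = 1) {j : V → V'} (hj : Function.Injective j)
    (f : (V → S) → ℝ) : iidExp (V := V') p (fun s => f (s ∘ j)) = iidExp p f := by
  classical
  let e : V ⊕ ↥(Set.range j)ᶜ ≃ V' :=
    ((Equiv.ofInjective j hj).sumCongr (Equiv.refl _)).trans (Equiv.Set.sumCompl (Set.range j))
  rw [iidExp_equiv e.symm, iidExp_sum_type]
  congr 1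
  funext s
  have : ∀ s' : ↥(Set.range j)ᶜ → S, (Sum.elim s s' ∘ e.symm) ∘ j = s := by
    intro s'
    funext v
    have hv : e.symm (j v) = Sum.inl v := by
      rw [Equiv.symm_apply_eq]
      rfl
    simp [hv]
  simp only [this]
  exact iidExp_const hp1 _

theorem iidExp_copies {ι A : Type} [Fintype ι] [DecidableEq ι] [Fintype A] [DecidableEq A]
    (f : (ι × A → S) → ℝ) :
    iidExp p f = iidExp (V := ι) (S := A → S) (fun t => ∏ a, p (t a))
      (fun t => f fun x => t x.1 x.2) := by
  unfold iidExp
  rw [Fintype.sum_equiv (Equiv.curry ι A S) _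
    (fun t => (∏ i, ∏ a, p (t i a)) * f fun x => t x.1 x.2)]
  intro s
  rw [Fintype.prod_prod_type]
  rfl

theorem iidExp_resample (hp1 : ∑ σ, p σ = 1) (w : V) (f : (V → S) → ℝ) :
    iidExp p f = iidExp p (fun s => ∑ σ, p σ * f (Function.update s w σ)) := by
  have key : ∀ g : (V → S) → ℝ, iidExp p g = ∑ τ : {v // v ≠ w} → S, ∑ σ, (p σ * ∏ v, p (τ v)) *
      g ((Equiv.funSplitAt w S).symm (σ, τ)) := by
    intro g
    unfold iidExp
    rw [Fintype.sum_equiv (Equiv.funSplitAt w S) _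
      (fun x => (p x.1 * ∏ v, p (x.2 v)) * g ((Equiv.funSplitAt w S).symm x)),
      Fintype.sum_prod_type, Finset.sum_comm]
    intro s
    rw [Equiv.symm_apply_apply, Fintype.prod_eq_mul_prod_subtype_ne _ w]
    rfl
  have hu : ∀ (σ σ' : S) (τ : {v // v ≠ w} → S),
      Function.update ((Equiv.funSplitAt w S).symm (σ, τ)) w σ' =
        (Equiv.funSplitAt w S).symm (σ', τ) := by
    intro σ σ' τ
    funext v
    by_cases hv : v = w
    · subst hv
      simp [Equiv.funSplitAt, Equiv.piSplitAt]
    · simp [Equiv.funSplitAt, Equiv.piSplitAt, hv]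
  rw [key, key]
  refine Finset.sum_congr rfl fun τ _ => ?_
  simp only [hu]
  simp only [mul_assoc]
  rw [← Finset.sum_mul, hp1, one_mul, Finset.mul_sum]
  exact Finset.sum_congr rfl fun σ _ => by ring

/-- A set of `card K` guesses that does not depend on coordinate `w` contains a label of
coordinate `w` with probability at most `card K * a`, if each label has probability at most `a`. -/
theorem iidProb_guess_le {I K : Type} [Fintype K] (hp : ∀ σ, 0 ≤ p σ) (hp1 : ∑ σ, p σ = 1)
    (label : S → I) {a : ℝ}
    (ha : ∀ x, ∑ σ, p σ * (label ⁻¹' {x}).indicator 1 σ ≤ a) (ha0 : 0 ≤ a) (w : V)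
    (X : (V → S) → K → Option I)
    (hX : ∀ s s' : V → S, (∀ v, v ≠ w → s v = s' v) → X s = X s') :
    iidProb p {s : V → S | ∃ k, X s k = some (label (s w))} ≤ Fintype.card K * a := by
  classical
  have hset : {s : V → S | ∃ k, X s k = some (label (s w))} =
      ⋃ k, {s : V → S | X s k = some (label (s w))} := by
    ext s
    simp
  rw [hset]
  refine (iidProb_iUnion_le hp _).trans ?_
  have h : ∀ k : K, iidProb p {s : V → S | X s k = some (label (s w))} ≤ a := by
    intro k
    unfold iidProb
    -- Draw coordinate `w` afresh: the guess stays fixed while the label varies, so the bound holds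
    -- conditionally on the other coordinates.
    rw [iidExp_resample hp1 w, ← iidExp_const (V := V) hp1 a]
    refine iidExp_mono hp fun s => ?_
    have hXs : ∀ σ, X (Function.update s w σ) = X s := fun σ =>
      hX _ _ fun v hv => Function.update_of_ne hv _ _
    rcases hx : X s k with _ | x
    · refine le_trans (le_of_eq ?_) ha0
      refine Finset.sum_eq_zero fun σ _ => ?_
      simp [hXs, hx]
    · refine le_trans (le_of_eq ?_) (ha x)
      refine Finset.sum_congr rfl fun σ _ => ?_
      congr 1
      simp only [Set.indicator_apply, Set.mem_ofPred_eq, hXs, hx, Function.update_self,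
        Option.some.injEq, Set.mem_preimage, Set.mem_singleton_iff, eq_comm, Pi.one_apply]
  refine (Finset.sum_le_sum fun k _ => h k).trans ?_
  simp

/-- If `q c` is the probability of the value `c`, three independent values agree with probability `∑
q c ^ 3`, and the power mean inequality bounds this below. -/
theorem iidProb_coincidence {O : Type} [Fintype O] (hp : ∀ σ, 0 ≤ p σ) (hp1 : ∑ σ, p σ = 1)
    (o : S → O) : ((Fintype.card O : ℝ) ^ 2)⁻¹ ≤
      iidProb (V := Fin 3) p {t | ∃ c, ∀ k, o (t k) = c} := by
  classical
  let q : O → ℝ := fun c => ∑ σ, p σ * if o σ = c then 1 else 0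
  have hq0 : ∀ c, 0 ≤ q c := fun c => Finset.sum_nonneg fun σ _ =>
    mul_nonneg (hp σ) (by split_ifs <;> norm_num)
  have hq1 : ∑ c, q c = 1 := by
    simp only [q]
    rw [Finset.sum_comm]
    simpa using hp1
  have hpow : ((Fintype.card O : ℝ) ^ 2)⁻¹ ≤ ∑ c, q c ^ 3 := by
    have := pow_sum_div_card_le_sum_pow (s := Finset.univ) (f := q) (fun c _ => hq0 c) 2
    rw [hq1] at this
    simpa using this
  refine hpow.trans ?_
  have hcube : ∀ c, q c ^ 3 =
      iidExp (V := Fin 3) p (fun t => ∏ k, if o (t k) = c then (1 : ℝ) else 0) := by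
    intro c
    unfold iidExp
    simp only [q]
    rw [Fintype.sum_pow]
    exact Finset.sum_congr rfl fun t _ => Finset.prod_mul_distrib
  simp only [hcube]
  rw [← iidExp_finset_sum]
  refine iidExp_mono hp fun t => ?_
  have hval : ∀ c, (∏ k, if o (t k) = c then (1 : ℝ) else 0) =
      if ∀ k, o (t k) = c then 1 else 0 := by
    intro c
    rw [Finset.prod_boole]
    simp
  simp only [hval]
  by_cases h : ∃ c, ∀ k, o (t k) = c
  · obtain ⟨c, hc⟩ := h
    rw [Set.indicator_of_mem (show t ∈ {t : Fin 3 → S | ∃ c, ∀ k, o (t k) = c} from ⟨c, hc⟩),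
      Finset.sum_eq_single c]
    · simp [hc]
    · intro c' _ hne
      rw [if_neg]
      exact fun h' => hne ((h' 0).symm.trans (hc 0))
    · simp
  · rw [Finset.sum_eq_zero]
    · exact Set.indicator_nonneg (fun _ _ => zero_le_one) t
    · intro c _
      rw [if_neg]
      exact fun h' => h ⟨c, h'⟩

end IID


/-! ### The layered network and its diameter -/

section Layered

variable {V : Type}

/-- The graph in which two nodes are adjacent if their layers differ by at most one. -/
def layeredGraph (lay : V → ℕ) : SimpleGraph V where
  Adj u v := u ≠ v ∧ lay u ≤ lay v + 1 ∧ lay v ≤ lay u + 1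
  symm := ⟨fun _ _ h => ⟨h.1.symm, h.2.2, h.2.1⟩⟩
  loopless := ⟨fun _ h => h.1 rfl⟩

variable {lay : V → ℕ}

theorem lay_le_add_length {u v : V} (p : (layeredGraph lay).Walk u v) :
    lay v ≤ lay u + p.length := by
  induction p with
  | nil => simp
  | cons h p ih =>
    have := h.2.2
    rw [SimpleGraph.Walk.length_cons]
    omega

/-- One edge climbs one layer. Distinct nodes of the same layer also need an edge, hence `max 1 k`.
-/
theorem exists_walk_of_lay_eq_add {D : ℕ} (hsurj : ∀ l ≤ D, ∃ v, lay v = l) :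
    ∀ (k : ℕ) (u v : V), lay v = lay u + k → lay v ≤ D →
      ∃ p : (layeredGraph lay).Walk u v, p.length ≤ max 1 k := by
  intro k
  induction k with
  | zero =>
    intro u v h _
    by_cases huv : u = v
    · subst huv
      exact ⟨SimpleGraph.Walk.nil, by simp⟩
    · exact ⟨(show (layeredGraph lay).Adj u v from ⟨huv, by omega, by omega⟩).toWalk, by simp⟩
  | succ k ih =>
    intro u v h hD
    rcases Nat.eq_zero_or_pos k with rfl | hk
    · have huv : u ≠ v := by
        rintro rfl
        omega
      exact ⟨(show (layeredGraph lay).Adj u v from ⟨huv, by omega, by omega⟩).toWalk, by simp⟩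
    · obtain ⟨w, hw⟩ := hsurj (lay u + 1) (by omega)
      obtain ⟨p, hp⟩ := ih w v (by omega) hD
      have huw : u ≠ w := by
        rintro rfl
        omega
      refine ⟨SimpleGraph.Walk.cons (show (layeredGraph lay).Adj u w from
        ⟨huw, by omega, by omega⟩) p, ?_⟩
      rw [SimpleGraph.Walk.length_cons]
      omega

theorem exists_walk_layeredGraph {D : ℕ} (hD : 1 ≤ D) (hle : ∀ v, lay v ≤ D)
    (hsurj : ∀ l ≤ D, ∃ v, lay v = l) (u v : V) :
    ∃ p : (layeredGraph lay).Walk u v, p.length ≤ D := by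
  have hu := hle u
  have hv := hle v
  rcases le_total (lay u) (lay v) with h | h
  · obtain ⟨p, hp⟩ := exists_walk_of_lay_eq_add hsurj (lay v - lay u) u v (by omega) hv
    exact ⟨p, by omega⟩
  · obtain ⟨p, hp⟩ := exists_walk_of_lay_eq_add hsurj (lay u - lay v) v u (by omega) hu
    exact ⟨p.reverse, by rw [SimpleGraph.Walk.length_reverse]; omega⟩

theorem layeredGraph_connected {D : ℕ} (hD : 1 ≤ D) (hle : ∀ v, lay v ≤ D)
    (hsurj : ∀ l ≤ D, ∃ v, lay v = l) : (layeredGraph lay).Connected := by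
  obtain ⟨v, -⟩ := hsurj 0 (Nat.zero_le _)
  have : Nonempty V := ⟨v⟩
  exact ⟨fun u v => (exists_walk_layeredGraph hD hle hsurj u v).elim fun p _ => ⟨p⟩⟩

theorem layeredGraph_diam [Finite V] {D : ℕ} (hD : 1 ≤ D) (hle : ∀ v, lay v ≤ D)
    (hsurj : ∀ l ≤ D, ∃ v, lay v = l) : (layeredGraph lay).diam = D := by
  have hconn := layeredGraph_connected hD hle hsurj
  obtain ⟨u₀, hu₀⟩ := hsurj 0 (Nat.zero_le _)
  obtain ⟨v₀, hv₀⟩ := hsurj D le_rfl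
  have : Nonempty V := ⟨u₀⟩
  apply le_antisymm
  · obtain ⟨u, v, h⟩ := SimpleGraph.exists_dist_eq_diam (G := layeredGraph lay)
    obtain ⟨p, hp⟩ := exists_walk_layeredGraph hD hle hsurj u v
    rw [← h]
    exact (SimpleGraph.dist_le p).trans hp
  · obtain ⟨p, hp⟩ := hconn.exists_walk_length_eq_dist u₀ v₀
    have h1 := lay_le_add_length p
    have h2 := SimpleGraph.dist_le_diam (SimpleGraph.connected_iff_ediam_ne_top.1 hconn)
      (u := u₀) (v := v₀)
    omega

/-- The layers of the hard network: the first `n - D + 1` nodes alternate between the layers `0`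
and `1`, and each of the layers `2, …, D` holds one of the other nodes. -/
def hardLayer (n D : ℕ) (i : Fin n) : ℕ :=
  if (i : ℕ) < n + 1 - D then i % 2 else i + D + 1 - n

theorem hardLayer_le {n D : ℕ} (hD : 1 ≤ D) (i : Fin n) : hardLayer n D i ≤ D := by
  have := i.2
  unfold hardLayer
  split_ifs <;> omega

theorem exists_hardLayer_eq {n D : ℕ} (hDn : D < n) (l : ℕ) (hl : l ≤ D) :
    ∃ i, hardLayer n D i = l := by
  unfold hardLayer
  by_cases h : l < 2
  · exact ⟨⟨l, by omega⟩, by rw [if_pos (by simp only; omega)]; simp only; omega⟩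
  · exact ⟨⟨l + n - D - 1, by omega⟩, by rw [if_neg (by simp only; omega)]; simp only; omega⟩

end Layered


/-! ### What an observation depends on -/

section Observations

variable {V M : Type} {G : SimpleGraph V} {a a' : V → Option M} {v v' : V}

theorem radioObs_of_isSome (h : (a v).isSome) : radioObs G a v = .own := by
  simp [radioObs, h]

theorem radioObs_of_unique {u : V} {m : M} (hv : a v = none) (hu : G.Adj v u) (hm : a u = some m)
    (huniq : ∀ w, G.Adj v w → (a w).isSome → w = u) : radioObs G a v = .packet m := by
  have h : ∃! u, G.Adj v u ∧ (a u).isSome := ⟨u, ⟨hu, by simp [hm]⟩, fun w hw => huniq w hw.1 hw.2⟩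
  have hc : h.choose = u := huniq _ h.choose_spec.1.1 h.choose_spec.1.2
  unfold radioObs
  rw [if_neg (by simp [hv]), dif_pos h]
  congr 1
  apply Option.some_injective
  rw [Option.some_get, hc, hm]

theorem radioObs_of_two {u w : V} (hv : a v = none) (hu : G.Adj v u) (hau : (a u).isSome)
    (hw : G.Adj v w) (haw : (a w).isSome) (hne : u ≠ w) : radioObs G a v = .collision := by
  unfold radioObs
  rw [if_neg (by simp [hv]), dif_neg, if_pos ⟨u, hu, hau⟩]
  exact fun h => hne (h.unique ⟨hu, hau⟩ ⟨hw, haw⟩)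

theorem radioObs_of_forall_none (hv : a v = none) (h : ∀ u, G.Adj v u → a u = none) :
    radioObs G a v = .silence := by
  have h' : ¬ ∃ u, G.Adj v u ∧ (a u).isSome := by
    rintro ⟨u, hu, hs⟩
    simp [h u hu] at hs
  unfold radioObs
  rw [if_neg (by simp [hv]), dif_neg fun hu => h' hu.exists, if_neg h']

/-- Only the transmitting neighbours and their packets matter, and only to a listener. Two different
nodes are allowed so that twins can be compared. -/
theorem radioObs_congr (hv : (a v).isSome = (a' v').isSome)
    (h : a v = none → ∀ u m, G.Adj v u ∧ a u = some m ↔ G.Adj v' u ∧ a' u = some m) :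
    radioObs G a v = radioObs G a' v' := by
  by_cases hs : (a v).isSome
  · rw [radioObs_of_isSome hs, radioObs_of_isSome (hv ▸ hs)]
  have hn : a v = none := by simpa using hs
  have hn' : a' v' = none := by
    rw [hv] at hs
    simpa using hs
  specialize h hn
  by_cases hex : ∃ u, G.Adj v u ∧ (a u).isSome
  · obtain ⟨u, hu, hau⟩ := hex
    obtain ⟨m, hm⟩ := Option.isSome_iff_exists.1 hau
    obtain ⟨hu', hm'⟩ := (h u m).1 ⟨hu, hm⟩
    by_cases hw : ∃ w, G.Adj v w ∧ (a w).isSome ∧ u ≠ w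
    · obtain ⟨w, hw, haw, hne⟩ := hw
      obtain ⟨k, hk⟩ := Option.isSome_iff_exists.1 haw
      obtain ⟨hw', hk'⟩ := (h w k).1 ⟨hw, hk⟩
      rw [radioObs_of_two hn hu hau hw haw hne,
        radioObs_of_two hn' hu' (by simp [hm']) hw' (by simp [hk']) hne]
    · rw [radioObs_of_unique hn hu hm, radioObs_of_unique hn' hu' hm']
      · intro w hw' hs'
        obtain ⟨k, hk⟩ := Option.isSome_iff_exists.1 hs'
        obtain ⟨h1, h2⟩ := (h w k).2 ⟨hw', hk⟩
        by_contra hne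
        exact hw ⟨w, h1, by simp [h2], Ne.symm hne⟩
      · intro w h1 h2
        by_contra hne
        exact hw ⟨w, h1, h2, Ne.symm hne⟩
  · rw [radioObs_of_forall_none hn, radioObs_of_forall_none hn']
    · intro u hu
      by_contra hne
      obtain ⟨m, hm⟩ := Option.ne_none_iff_exists'.1 hne
      obtain ⟨h1, h2⟩ := (h u m).2 ⟨hu, hm⟩
      exact hex ⟨u, h1, by simp [h2]⟩
    · intro u hu
      by_contra hne
      exact hex ⟨u, hu, Option.isSome_iff_ne_none.2 hne⟩

theorem observe_congr {model : Model} {a a' : V → Option model.Packet} (hv : a v = a' v)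
    (h : ∀ u, G.Adj v u → a u = a' u) : model.observe G a v = model.observe G a' v := by
  cases model with
  | radioCD p =>
    refine radioObs_congr (by rw [hv]) fun _ u m => ?_
    exact and_congr_right fun hu => by rw [h u hu]
  | beep =>
    have hex : (∃ u, G.Adj v u ∧ (a u).isSome) ↔ ∃ u, G.Adj v u ∧ (a' u).isSome :=
      exists_congr fun u => and_congr_right fun hu => by rw [h u hu]
    simp only [Model.observe, beepObs, hv]
    split_ifs with h1 h2 h3 h3
    · rfl
    · rfl
    · exact absurd (hex.1 h2) h3
    · exact absurd (hex.2 h3) h2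
    · rfl

end Observations

/-! ### Runs with all nodes awake, locality, and uninformative histories -/

section Runs

variable {V : Type} {model : Model}

/-- The observations of all nodes after `r` rounds if all are awake from the beginning, where `act`
gives the action of a node for each list of its observations. -/
noncomputable def run (G : SimpleGraph V)
    (act : V → List (Obs model.Packet) → Option model.Packet) : ℕ → V → List (Obs model.Packet)
  | 0, _ => []
  | r + 1, v => model.observe G (fun u => act u (run G act r u)) v :: run G act r v

/-- The actions of all nodes in round `r`. -/
noncomputable def roundAct (G : SimpleGraph V)
    (act : V → List (Obs model.Packet) → Option model.Packet) (r : ℕ) (v : V) :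
    Option model.Packet :=
  act v (run G act r v)

theorem run_succ (G : SimpleGraph V)
    (act : V → List (Obs model.Packet) → Option model.Packet) (r : ℕ) (v : V) :
    run G act (r + 1) v = model.observe G (roundAct G act r) v :: run G act r v :=
  rfl

theorem length_run (G : SimpleGraph V)
    (act : V → List (Obs model.Packet) → Option model.Packet) (r : ℕ) (v : V) :
    (run G act r v).length = r := by
  induction r with
  | zero => rfl
  | succ r ih => simp [run, ih]

theorem view_univ {b : ℕ} (P : Protocol model b) (G : SimpleGraph V) (s : V → ID b × P.Tape)
    (r : ℕ) (v : V) :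
    P.view G Set.univ s r v = some (run G (fun u => P.act (s u).1 (s u).2) r v) := by
  induction r generalizing v with
  | zero => simp [Protocol.view, run]
  | succ r ih => simp [Protocol.view, run, ih]

theorem run_congr_of_short {G : SimpleGraph V} {T : ℕ}
    {act act' : V → List (Obs model.Packet) → Option model.Packet}
    (h : ∀ v l, l.length ≤ T → act v l = act' v l) (r : ℕ) (hr : r ≤ T) (v : V) :
    run G act r v = run G act' r v := by
  induction r generalizing v with
  | zero => rfl
  | succ r ih =>
    have ih' := fun v => ih (by omega) v
    have hact : roundAct G act r = roundAct G act' r := by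
      funext u
      rw [roundAct, roundAct, h u _ (by rw [length_run]; omega), ih' u]
    rw [run_succ, run_succ, hact, ih' v]

/-- Information crosses at most one layer per round. -/
theorem run_layered_local {lay : V → ℕ}
    {act act' : V → List (Obs model.Packet) → Option model.Packet} (r : ℕ) (v : V)
    (h : ∀ w, lay w ≤ lay v + r → lay v ≤ lay w + r → act w = act' w) :
    run (layeredGraph lay) act r v = run (layeredGraph lay) act' r v := by
  induction r generalizing v with
  | zero => rfl
  | succ r ih =>
    have ih' : ∀ u, lay u ≤ lay v + 1 → lay v ≤ lay u + 1 →
        run (layeredGraph lay) act r u = run (layeredGraph lay) act' r u := fun u h1 h2 =>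
      ih u fun w h3 h4 => h w (by omega) (by omega)
    have hact : ∀ u, lay u ≤ lay v + 1 → lay v ≤ lay u + 1 →
        roundAct (layeredGraph lay) act r u = roundAct (layeredGraph lay) act' r u :=
      fun u h1 h2 => by rw [roundAct, roundAct, h u (by omega) (by omega), ih' u h1 h2]
    rw [run_succ, run_succ, ih' v (by omega) (by omega)]
    congr 1
    exact observe_congr (hact v (by omega) (by omega)) fun u hu => hact u hu.2.2 hu.2.1

/-- What a listening node perceives if it perceives neither silence nor a packet. -/
def Model.loud : (model : Model) → Obs model.Packet
  | .radioCD _ => .collision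
  | .beep => .beep

/-- The observations after `r` rounds of a node that acts according to `act` and perceives, when it
listens in round `i`, silence or `model.loud` according to `o i`. -/
def soloRun (act : List (Obs model.Packet) → Option model.Packet) (o : ℕ → Bool) :
    ℕ → List (Obs model.Packet)
  | 0 => []
  | r + 1 =>
    (if (act (soloRun act o r)).isSome then .own
      else if o r then model.loud else .silence) :: soloRun act o r

theorem soloRun_congr {act : List (Obs model.Packet) → Option model.Packet} {o o' : ℕ → Bool}
    (r : ℕ) (h : ∀ i < r, o i = o' i) : soloRun act o r = soloRun act o' r := by
  induction r with
  | zero => rfl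
  | succ r ih =>
    simp only [soloRun, ih fun i hi => h i (by omega), h r (by omega)]

/-- One bit per round suffices to reconstruct such a history from the node's own behaviour; this
leaves only `2 ^ T` candidates. -/
theorem exists_run_eq_soloRun {G : SimpleGraph V}
    {act : V → List (Obs model.Packet) → Option model.Packet} {v : V} {T : ℕ}
    (h : ∀ r < T, roundAct G act r v = none →
      model.observe G (roundAct G act r) v = .silence ∨
      model.observe G (roundAct G act r) v = model.loud) :
    ∃ o : Fin T → Bool, run G act T v =
      soloRun (act v) (fun i => if hi : i < T then o ⟨i, hi⟩ else false) T := by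
  classical
  let o : ℕ → Bool := fun r =>
    decide (model.observe G (roundAct G act r) v = model.loud)
  have hown : ∀ a : V → Option model.Packet, (a v).isSome → model.observe G a v = .own := by
    intro a ha
    cases model with
    | radioCD p => exact radioObs_of_isSome ha
    | beep => simp [Model.observe, beepObs, ha]
  have key : ∀ r ≤ T, run G act r v = soloRun (act v) o r := by
    intro r
    induction r with
    | zero => intro _; rfl
    | succ r ih =>
      intro hr
      have ih' := ih (by omega)
      rw [run_succ, soloRun, ← ih']
      congr 1
      by_cases hs : (act v (run G act r v)).isSome
      · rw [if_pos hs]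
        exact hown _ hs
      · rw [if_neg hs]
        by_cases hl : model.observe G (roundAct G act r) v = model.loud
        · simp [o, hl]
        · have : o r = false := by simp [o, hl]
          rw [this]
          exact ((h r (by omega) (by simpa [roundAct] using hs)).resolve_right hl)
  refine ⟨fun i => o i, ?_⟩
  rw [key T le_rfl]
  refine soloRun_congr T fun i hi => ?_
  simp [hi]

theorem beep_silence_or_loud (G : SimpleGraph V) (a : V → Option Model.beep.Packet) (v : V)
    (hv : a v = none) : Model.beep.observe G a v = .silence ∨
      Model.beep.observe G a v = Model.beep.loud := by
  simp only [Model.observe, beepObs, hv, Model.loud]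
  by_cases h : ∃ u, G.Adj v u ∧ (a u).isSome <;> simp [h]

end Runs


/-! ### Three copies: hiding all packets behind collisions -/

section Copies

variable {V A : Type} {p T : ℕ} {lay : V → ℕ}

/-- In round `r` some node of layer `l` transmits. -/
def Busy (lay : V → ℕ)
    (act : V → List (Obs (Model.radioCD p).Packet) → Option (Model.radioCD p).Packet)
    (r l : ℕ) : Prop :=
  ∃ v, lay v = l ∧ (roundAct (layeredGraph lay) act r v).isSome

/-- The nodes of the layers `0` and `1` are arranged in three copies of `A`, of which the first two
are complete; copies of the same element are in the same layer. -/
structure CoreCopies (lay : V → ℕ) (j : V → (Fin 3 × A) ⊕ V) : Prop where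
  injective : Function.Injective j
  lay_lt : ∀ v x, j v = Sum.inl x → lay v < 2
  le_lay : ∀ v w, j v = Sum.inr w → 2 ≤ lay v
  lay_eq : ∀ v v' k k' a, j v = Sum.inl (k, a) → j v' = Sum.inl (k', a) → lay v = lay v'
  exists_zero : ∀ a, ∃ v, j v = Sum.inl (0, a)
  exists_one : ∀ a, ∃ v, j v = Sum.inl (1, a)

variable {j : V → (Fin 3 × A) ⊕ V}
  {t : Fin 3 → A → List (Obs (Model.radioCD p).Packet) → Option (Model.radioCD p).Packet}
  {z : V → List (Obs (Model.radioCD p).Packet) → Option (Model.radioCD p).Packet}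

/-- Each copy of `A` uses its own assignment `t k`. -/
def mixed {B : Type} (j : V → (Fin 3 × A) ⊕ V) (t : Fin 3 → A → B) (z : V → B) (v : V) : B :=
  Sum.elim (fun x => t x.1 x.2) z (j v)

/-- All three copies of `A` use the same assignment `τ`. -/
def duplicated {B : Type} (j : V → (Fin 3 × A) ⊕ V) (τ : A → B) (z : V → B) (v : V) : B :=
  Sum.elim (fun x => τ x.2) z (j v)

/-- Twins share a layer, so their neighbourhoods differ only in the twins themselves. By induction
they act alike; when they listen neither transmits, so the difference is invisible. -/
theorem run_duplicated_twin (hj : CoreCopies lay j) {τ : A → List (Obs (Model.radioCD p).Packet) →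
      Option (Model.radioCD p).Packet} {v v' : V} {k k' : Fin 3} {a : A}
    (hv : j v = Sum.inl (k, a)) (hv' : j v' = Sum.inl (k', a)) (r : ℕ) :
    run (layeredGraph lay) (duplicated j τ z) r v =
      run (layeredGraph lay) (duplicated j τ z) r v' := by
  have hl := hj.lay_eq v v' k k' a hv hv'
  induction r with
  | zero => rfl
  | succ r ih =>
    rw [run_succ, run_succ, ih]
    congr 1
    have hact : roundAct (layeredGraph lay) (duplicated j τ z) r v =
        roundAct (layeredGraph lay) (duplicated j τ z) r v' := by
      rw [roundAct, roundAct, ih]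
      simp [duplicated, hv, hv']
    refine radioObs_congr (by rw [hact]) fun hnone u m => ?_
    have hnone' := hact.symm.trans hnone
    constructor
    · rintro ⟨⟨-, h1, h2⟩, hm⟩
      refine ⟨⟨?_, by omega, by omega⟩, hm⟩
      rintro rfl
      rw [hnone'] at hm
      cases hm
    · rintro ⟨⟨-, h1, h2⟩, hm⟩
      refine ⟨⟨?_, by omega, by omega⟩, hm⟩
      rintro rfl
      rw [hnone] at hm
      cases hm

theorem exists_copies_of_busy (hj : CoreCopies lay j) {τ : A → List (Obs (Model.radioCD p).Packet) →
      Option (Model.radioCD p).Packet} {r l : ℕ} (hl : l < 2)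
    (h : Busy lay (duplicated j τ z) r l) :
    ∃ a v₀ v₁, j v₀ = Sum.inl (0, a) ∧ j v₁ = Sum.inl (1, a) ∧ lay v₀ = l ∧ lay v₁ = l ∧
      (roundAct (layeredGraph lay) (duplicated j τ z) r v₀).isSome ∧
      (roundAct (layeredGraph lay) (duplicated j τ z) r v₁).isSome := by
  obtain ⟨v, hv, hs⟩ := h
  rcases hjv : j v with ⟨k, a⟩ | w
  · obtain ⟨v₀, h0⟩ := hj.exists_zero a
    obtain ⟨v₁, h1⟩ := hj.exists_one a
    refine ⟨a, v₀, v₁, h0, h1, (hj.lay_eq _ _ _ _ _ h0 hjv).trans hv,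
      (hj.lay_eq _ _ _ _ _ h1 hjv).trans hv, ?_, ?_⟩
    · rw [roundAct, run_duplicated_twin hj h0 hjv]
      simpa [roundAct, duplicated, h0, hjv] using hs
    · rw [roundAct, run_duplicated_twin hj h1 hjv]
      simpa [roundAct, duplicated, h1, hjv] using hs
  · have := hj.le_lay v w hjv
    omega

theorem mixed_eq_duplicated {B : Type} {t : Fin 3 → A → B} {z : V → B} {v : V} {k : Fin 3}
    (h : ∀ x, j v = Sum.inl x → x.1 = k) : mixed j t z v = duplicated j (t k) z v := by
  unfold mixed duplicated
  rcases hjv : j v with x | w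
  · simp [h x hjv]
  · rfl

/-- If the three assignments yield the same busy rounds when each is used by all copies, then in the
mixed run each node perceives the same as if its own copy's assignment was used by all copies. -/
theorem run_mixed (hj : CoreCopies lay j)
    (hbusy : ∀ k k', ∀ r < T, ∀ l < 2,
      Busy lay (duplicated j (t k) z) r l → Busy lay (duplicated j (t k') z) r l)
    (r : ℕ) (hr : r ≤ T) (v : V) (k : Fin 3) (hv : ∀ x, j v = Sum.inl x → x.1 = k) :
    run (layeredGraph lay) (mixed j t z) r v =
      run (layeredGraph lay) (duplicated j (t k) z) r v := by
  induction r generalizing v k with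
  | zero => rfl
  | succ r ih =>
    have ih' := fun v k hv => ih (by omega) v k hv
    have hact : ∀ v k, (∀ x, j v = Sum.inl x → x.1 = k) →
        roundAct (layeredGraph lay) (mixed j t z) r v =
          roundAct (layeredGraph lay) (duplicated j (t k) z) r v := by
      intro v k hv
      rw [roundAct, roundAct, ih' v k hv, mixed_eq_duplicated hv]
    rw [run_succ, run_succ, ih' v k hv]
    congr 1
    have hav := hact v k hv
    rcases hnone : roundAct (layeredGraph lay) (duplicated j (t k) z) r v with
      _ | m
    swap
    · rw [hnone] at hav
      exact (radioObs_of_isSome (by simp [hav])).trans (radioObs_of_isSome (by simp [hnone])).symm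
    have hnone' := hav.trans hnone
    have hne : ∀ u, (roundAct (layeredGraph lay) (mixed j t z) r u).isSome → v ≠ u := by
      rintro u hu rfl
      simp [hnone'] at hu
    have hne' : ∀ u, (roundAct (layeredGraph lay) (duplicated j (t k) z) r u).isSome → v ≠ u := by
      rintro u hu rfl
      simp [hnone] at hu
    -- If a nearby core layer is busy, `v` detects a collision in both runs: twins collide in the
    -- duplicated run, and in the mixed run copies `0` and `1` each contribute a transmitter because
    -- their busy records agree.
    by_cases hl : ∃ l < 2, l ≤ lay v + 1 ∧ lay v ≤ l + 1 ∧ Busy lay (duplicated j (t k) z) r l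
    · obtain ⟨l, hl2, hl1, hl1', hb⟩ := hl
      obtain ⟨a, v₀, v₁, h0, h1, hl0, hl1, hs0, hs1⟩ := exists_copies_of_busy hj hl2 hb
      obtain ⟨a', u₀, -, g0, -, gl0, -, gs0, -⟩ :=
        exists_copies_of_busy hj hl2 (hbusy k 0 r (by omega) l hl2 hb)
      obtain ⟨a'', -, u₁, -, g1, -, gl1, -, gs1⟩ :=
        exists_copies_of_busy hj hl2 (hbusy k 1 r (by omega) l hl2 hb)
      rw [← hact u₀ 0 (by simp [g0])] at gs0
      rw [← hact u₁ 1 (by simp [g1])] at gs1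
      have hv01 : v₀ ≠ v₁ := by
        rintro rfl
        simp [h0] at h1
      have hu01 : u₀ ≠ u₁ := by
        rintro rfl
        simp [g0] at g1
      refine (radioObs_of_two (G := layeredGraph lay) hnone'
          ⟨hne u₀ gs0, ?_, ?_⟩ gs0 ⟨hne u₁ gs1, ?_, ?_⟩ gs1 hu01).trans
        (radioObs_of_two (G := layeredGraph lay) hnone
          ⟨hne' v₀ hs0, ?_, ?_⟩ hs0 ⟨hne' v₁ hs1, ?_, ?_⟩ hs1 hv01).symm
      all_goals omega
    -- Otherwise no neighbour in layers `0` and `1` transmits in any of the runs. Nodes outside the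
    -- copies satisfy the induction hypothesis for every `k`, so they act identically.
    · refine observe_congr hav fun u hu => ?_
      rcases hju : j u with ⟨k', a⟩ | w
      · have hlu := hj.lay_lt u _ hju
        have hquiet : ∀ k', ¬ Busy lay (duplicated j (t k') z) r (lay u) := fun k' hb =>
          hl ⟨lay u, hlu, hu.2.2, hu.2.1, hbusy k' k r (by omega) _ hlu hb⟩
        rw [hact u k' (by simp [hju])]
        have e1 : ∀ k', roundAct (layeredGraph lay) (duplicated j (t k') z) r u = none := by
          intro k'
          by_contra hs
          exact hquiet k' ⟨u, rfl, Option.isSome_iff_ne_none.2 hs⟩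
        rw [e1, e1]
      · exact hact u k (by simp [hju])

/-- Layer `0` has neighbours only in layers `0` and `1`, so packets from the outer layers cannot
reach it directly; a busy core layer has transmitters in copies `0` and `1`. -/
theorem mixed_silence_or_collision (hj : CoreCopies lay j)
    (hbusy : ∀ k k', ∀ r < T, ∀ l < 2,
      Busy lay (duplicated j (t k) z) r l → Busy lay (duplicated j (t k') z) r l)
    {v : V} (hv : lay v = 0) {r : ℕ} (hr : r < T)
    (hnone : roundAct (layeredGraph lay) (mixed j t z) r v = none) :
    (Model.radioCD p).observe (layeredGraph lay)
        (roundAct (layeredGraph lay) (mixed j t z) r) v = .silence ∨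
      (Model.radioCD p).observe (layeredGraph lay)
        (roundAct (layeredGraph lay) (mixed j t z) r) v =
          (Model.radioCD p).loud := by
  have hact : ∀ v k, (∀ x, j v = Sum.inl x → x.1 = k) →
      roundAct (layeredGraph lay) (mixed j t z) r v =
        roundAct (layeredGraph lay) (duplicated j (t k) z) r v := by
    intro v k hv
    rw [roundAct, roundAct, run_mixed hj hbusy r hr.le v k hv, mixed_eq_duplicated hv]
  by_cases hl : ∃ l < 2, Busy lay (duplicated j (t 0) z) r l
  · right
    obtain ⟨l, hl2, hb⟩ := hl
    obtain ⟨a', u₀, -, g0, -, gl0, -, gs0, -⟩ := exists_copies_of_busy hj hl2 hb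
    obtain ⟨a'', -, u₁, -, g1, -, gl1, -, gs1⟩ :=
      exists_copies_of_busy hj hl2 (hbusy 0 1 r hr l hl2 hb)
    rw [← hact u₀ 0 (by simp [g0])] at gs0
    rw [← hact u₁ 1 (by simp [g1])] at gs1
    have hu01 : u₀ ≠ u₁ := by
      rintro rfl
      simp [g0] at g1
    have hne : ∀ u, (roundAct (layeredGraph lay) (mixed j t z) r u).isSome → v ≠ u := by
      rintro u hu rfl
      simp [hnone] at hu
    refine radioObs_of_two (G := layeredGraph lay) hnone
      ⟨hne u₀ gs0, ?_, ?_⟩ gs0 ⟨hne u₁ gs1, ?_, ?_⟩ gs1 hu01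
    all_goals omega
  · left
    refine radioObs_of_forall_none hnone fun u hu => ?_
    have hlu : lay u < 2 := by
      have := hu.2.2
      omega
    rcases hju : j u with ⟨k', a⟩ | w
    · simp only [hact u k' (by simp [hju])]
      by_contra hs
      exact hl ⟨lay u, hlu, hbusy k' 0 r hr _ hlu ⟨u, rfl, Option.isSome_iff_ne_none.2 hs⟩⟩
    · have := hj.le_lay u w hju
      omega

end Copies


/-! ### Bounds on the success probability for finite seeds -/

section FiniteSeeds

variable {V S I : Type} {model : Model} {T : ℕ}

/-- A leader is elected after `T` rounds, where a node with seed `σ` acts according to `act σ`,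
outputs according to `out σ` and has the identifier `label σ`. -/
def SeedsElect (G : SimpleGraph V) (label : S → I)
    (act : S → List (Obs model.Packet) → Option model.Packet)
    (out : S → List (Obs model.Packet) → Option I) (T : ℕ) (s : V → S) : Prop :=
  ∃ x, (∃ u, label (s u) = x) ∧ ∀ v, out (s v) (run G (fun u => act (s u)) T v) = some x

/-- Up to round `T`, node `v` perceives only silence and noise when it listens. -/
def Uninformed (G : SimpleGraph V) (act : S → List (Obs model.Packet) → Option model.Packet)
    (T : ℕ) (v : V) (s : V → S) : Prop :=
  ∃ o : Fin T → Bool, run G (fun u => act (s u)) T v =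
    soloRun (act (s v)) (fun i => if hi : i < T then o ⟨i, hi⟩ else false) T

theorem uninformed_of_beep (G : SimpleGraph V)
    (act : S → List (Obs Model.beep.Packet) → Option Model.beep.Packet) (v : V) (s : V → S) :
    Uninformed G act T v s :=
  exists_run_eq_soloRun fun _ _ h => beep_silence_or_loud _ _ _ h

variable [Fintype V] [DecidableEq V] [Fintype S] {label : S → I}
  {act : S → List (Obs model.Packet) → Option model.Packet}
  {out : S → List (Obs model.Packet) → Option I} {p : S → ℝ} {a : ℝ}

/-- For each possible leader `w`, the guess is the output of whichever of `u` and `v` is too far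
away to be influenced by `w` within `T` rounds. -/
theorem iidProb_elect_le_of_far {lay : V → ℕ} {D : ℕ} (hp : ∀ σ, 0 ≤ p σ) (hp1 : ∑ σ, p σ = 1)
    (ha : ∀ x, ∑ σ, p σ * (label ⁻¹' {x}).indicator 1 σ ≤ a) (ha0 : 0 ≤ a)
    {u v : V} (hu : lay u = 0) (hv : lay v = D) (hT : 2 * T < D) :
    iidProb p {s | SeedsElect (layeredGraph lay) label act out T s} ≤ Fintype.card V * a := by
  let X : V → (V → S) → Unit → Option I := fun w s _ =>
    let x := if T < lay w then u else v
    out (s x) (run (layeredGraph lay) (fun u => act (s u)) T x)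
  have hsub : {s | SeedsElect (layeredGraph lay) label act out T s} ⊆
      ⋃ w, {s | ∃ k, X w s k = some (label (s w))} := by
    rintro s ⟨x, ⟨w, rfl⟩, h⟩
    exact Set.mem_iUnion.2 ⟨w, (), h _⟩
  refine (iidProb_mono hp hsub).trans ((iidProb_iUnion_le hp _).trans ?_)
  have hw : ∀ w, iidProb p {s | ∃ k, X w s k = some (label (s w))} ≤ a := by
    intro w
    have := iidProb_guess_le hp hp1 label ha ha0 w (X w) ?_
    · simpa using this
    intro s s' hss
    have hx : ∀ x : V, (T < lay w → x = u) → (¬ T < lay w → x = v) →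
        out (s x) (run (layeredGraph lay) (fun u => act (s u)) T x) =
          out (s' x) (run (layeredGraph lay) (fun u => act (s' u)) T x) := by
      intro x h1 h2
      have hfar : lay x + T < lay w ∨ lay w + T < lay x := by
        by_cases hT' : T < lay w
        · rw [h1 hT']
          omega
        · rw [h2 hT']
          omega
      have hxw : x ≠ w := by
        rintro rfl
        omega
      rw [hss x hxw, run_layered_local T x (act' := fun u => act (s' u))]
      intro y hy1 hy2
      have hyw : y ≠ w := by
        rintro rfl
        omega
      simp only [hss y hyw]
    funext _
    exact hx _ (fun h => if_pos h) (fun h => if_neg h)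
  refine (Finset.sum_le_sum fun w _ => hw w).trans ?_
  simp

/-- For each possible leader `w`, one of `u` and `v` differs from `w`. While uninformed, its output
is among the `2 ^ T` values obtained by feeding it all noise patterns, and these depend on its own
seed only. -/
theorem iidProb_elect_le_of_uninformed {G : SimpleGraph V} (hp : ∀ σ, 0 ≤ p σ)
    (hp1 : ∑ σ, p σ = 1) (ha : ∀ x, ∑ σ, p σ * (label ⁻¹' {x}).indicator 1 σ ≤ a) (ha0 : 0 ≤ a)
    {u v : V} (huv : u ≠ v) :
    iidProb p {s | SeedsElect G label act out T s} ≤ Fintype.card V * (2 ^ T * a) +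
      (1 - iidProb p {s | Uninformed G act T u s ∧ Uninformed G act T v s}) := by
  let X : V → (V → S) → (Fin T → Bool) → Option I := fun w s o =>
    let x := if w = u then v else u
    out (s x) (soloRun (act (s x)) (fun i => if hi : i < T then o ⟨i, hi⟩ else false) T)
  have hsub : {s | SeedsElect G label act out T s} ⊆
      (⋃ w, {s | ∃ k, X w s k = some (label (s w))}) ∪
        {s | Uninformed G act T u s ∧ Uninformed G act T v s}ᶜ := by
    rintro s ⟨x, ⟨w, rfl⟩, h⟩
    by_cases hF : Uninformed G act T u s ∧ Uninformed G act T v s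
    · left
      refine Set.mem_iUnion.2 ⟨w, ?_⟩
      have hx : Uninformed G act T (if w = u then v else u) s := by
        split_ifs
        · exact hF.2
        · exact hF.1
      obtain ⟨o, ho⟩ := hx
      refine ⟨o, ?_⟩
      have := h (if w = u then v else u)
      rw [ho] at this
      exact this
    · exact Or.inr hF
  refine (iidProb_mono hp hsub).trans ((iidProb_union_le hp _ _).trans ?_)
  rw [iidProb_compl hp1]
  refine add_le_add ((iidProb_iUnion_le hp _).trans ?_) le_rfl
  have hw : ∀ w, iidProb p {s | ∃ k, X w s k = some (label (s w))} ≤ 2 ^ T * a := by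
    intro w
    have := iidProb_guess_le hp hp1 label ha ha0 w (X w) ?_
    · simpa using this
    intro s s' hss
    have hne : (if w = u then v else u) ≠ w := by
      split_ifs with h
      · rw [h]
        exact huv.symm
      · exact Ne.symm h
    funext o
    simp only [X, hss _ hne]
  refine (Finset.sum_le_sum fun w _ => hw w).trans ?_
  simp

theorem iidProb_uninformed_radio {A : Type} [Fintype A] [DecidableEq A] {packetBits : ℕ}
    {lay : V → ℕ} {j : V → (Fin 3 × A) ⊕ V} (hj : CoreCopies lay j)
    (hp : ∀ σ, 0 ≤ p σ) (hp1 : ∑ σ, p σ = 1)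
    (act : S → List (Obs (Model.radioCD packetBits).Packet) →
      Option (Model.radioCD packetBits).Packet)
    {u v : V} (hu : lay u = 0) (hv : lay v = 0) :
    ((16 : ℝ) ^ T)⁻¹ ≤ iidProb p {s | Uninformed (layeredGraph lay) act T u s ∧
      Uninformed (layeredGraph lay) act T v s} := by
  classical
  set F := {s | Uninformed (layeredGraph lay) act T u s ∧ Uninformed (layeredGraph lay) act T v s}
  -- Realise the independent seeds as a mixed assignment, then condition on the seeds `z` used
  -- outside the copies.
  have hF : iidProb p F = iidExp (V := V) p fun z => iidExp (V := Fin 3) (S := A → S)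
      (fun τ => ∏ a, p (τ a)) fun t => F.indicator 1 (mixed j t z) := by
    unfold iidProb
    rw [← iidExp_comp_injective hp1 hj.injective, iidExp_equiv (Equiv.sumComm _ _),
      iidExp_sum_type]
    congr 1
    funext z
    rw [iidExp_copies]
    congr 1
    funext t
    congr 1
    funext v
    simp only [Function.comp, mixed]
    rcases j v with x | w <;> rfl
  rw [hF, ← iidExp_const (V := V) hp1 ((16 : ℝ) ^ T)⁻¹]
  refine iidExp_mono hp fun z => ?_
  let o : (A → S) → (Fin T × Fin 2 → Bool) := fun τ x =>
    decide (Busy lay (duplicated j (fun a => act (τ a)) fun v => act (z v)) x.1 x.2)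
  have hq0 : ∀ τ : A → S, 0 ≤ ∏ a, p (τ a) := fun τ => Finset.prod_nonneg fun a _ => hp _
  have hq1 : ∑ τ : A → S, ∏ a, p (τ a) = 1 := by
    rw [← Fintype.prod_sum (fun _ : A => p)]
    simp [hp1]
  -- A busy record has one bit per round and core layer, so there are `4 ^ T` records.
  have hcard : ((Fintype.card (Fin T × Fin 2 → Bool) : ℝ) ^ 2)⁻¹ = ((16 : ℝ) ^ T)⁻¹ := by
    simp only [Fintype.card_fun, Fintype.card_bool, Fintype.card_prod, Fintype.card_fin]
    push_cast
    rw [mul_comm T 2, pow_mul, ← pow_mul, mul_comm T 2, pow_mul]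
    norm_num
  rw [← hcard]
  refine (iidProb_coincidence hq0 hq1 o).trans (iidExp_mono hq0 fun t => ?_)
  by_cases ht : t ∈ {t | ∃ c, ∀ k, o (t k) = c}
  swap
  · rw [Set.indicator_of_notMem ht]
    exact Set.indicator_nonneg (fun _ _ => zero_le_one) _
  obtain ⟨c, hc⟩ := id ht
  have hbusy : ∀ k k', ∀ r < T, ∀ l < 2,
      Busy lay (duplicated j (fun a => act (t k a)) fun v => act (z v)) r l →
        Busy lay (duplicated j (fun a => act (t k' a)) fun v => act (z v)) r l := by
    intro k k' r hr l hl hb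
    have := congrFun ((hc k).trans (hc k').symm) (⟨r, hr⟩, ⟨l, hl⟩)
    simp only [o, decide_eq_decide] at this
    exact this.1 hb
  have hmix : (fun v => act (mixed j t z v)) =
      mixed j (fun k a => act (t k a)) fun v => act (z v) := by
    funext v
    unfold mixed
    rcases j v with x | w <;> rfl
  have hun : ∀ x, lay x = 0 → Uninformed (layeredGraph lay) act T x (mixed j t z) := by
    intro x hx
    refine exists_run_eq_soloRun fun r hr => ?_
    rw [hmix]
    exact mixed_silence_or_collision hj hbusy hx hr
  have hmem : mixed j t z ∈ F := ⟨hun u hu, hun v hv⟩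
  rw [Set.indicator_of_mem ht, Set.indicator_of_mem hmem]
  rfl

end FiniteSeeds

/-! ### Copies in the hard network -/

/-- The arrangement of the nodes of the layers `0` and `1` of the hard network in three copies of
`Fin q`, of which the last one may be incomplete. -/
def hardCopy (n D q : ℕ) (hq : 0 < q) (hn : n + 1 - D ≤ 3 * q) (i : Fin n) :
    (Fin 3 × Fin q) ⊕ Fin n :=
  if h : (i : ℕ) < n + 1 - D then
    Sum.inl (⟨i / q, Nat.div_lt_of_lt_mul (by omega)⟩, ⟨i % q, Nat.mod_lt _ hq⟩)
  else Sum.inr i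

theorem coreCopies_hardCopy {n D q : ℕ} (hq : 0 < q) (hn : n + 1 - D ≤ 3 * q)
    (hq2 : 2 ∣ q) (hqn : 2 * q ≤ n + 1 - D) (hD : 1 ≤ D) :
    CoreCopies (hardLayer n D) (hardCopy n D q hq hn) where
  injective := by
    intro i i' h
    unfold hardCopy at h
    split_ifs at h with h1 h2 h2
    · simp only [Sum.inl.injEq, Prod.mk.injEq, Fin.mk.injEq] at h
      apply Fin.ext
      rw [← Nat.div_add_mod (i : ℕ) q, ← Nat.div_add_mod (i' : ℕ) q, h.1, h.2]
    · exact Sum.inr_injective h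
  lay_lt := by
    intro i x h
    unfold hardCopy at h
    split_ifs at h with h1
    unfold hardLayer
    rw [if_pos h1]
    omega
  le_lay := by
    intro i x h
    unfold hardCopy at h
    split_ifs at h with h1
    unfold hardLayer
    rw [if_neg h1]
    omega
  lay_eq := by
    intro i i' k k' a h h'
    unfold hardCopy at h h'
    split_ifs at h h' with h1 h2
    simp only [Sum.inl.injEq, Prod.mk.injEq] at h h'
    unfold hardLayer
    -- Since `q` is even, the residue modulo `q` determines the parity, which is the layer.
    rw [if_pos h1, if_pos h2, ← Nat.mod_mod_of_dvd (i : ℕ) hq2, ← Nat.mod_mod_of_dvd (i' : ℕ) hq2,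
      show (i : ℕ) % q = a from congrArg Fin.val h.2,
      show (i' : ℕ) % q = a from congrArg Fin.val h'.2]
  exists_zero := by
    intro a
    have := a.2
    refine ⟨⟨a, by omega⟩, ?_⟩
    unfold hardCopy
    rw [dif_pos (by simp only; omega)]
    congr 2
    · apply Fin.ext
      simp [Nat.div_eq_of_lt this]
    · apply Fin.ext
      simp [Nat.mod_eq_of_lt this]
  exists_one := by
    intro a
    have := a.2
    refine ⟨⟨q + a, by omega⟩, ?_⟩
    unfold hardCopy
    rw [dif_pos (by simp only; omega)]
    congr 2
    · apply Fin.ext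
      simp [Nat.add_div_left, hq, Nat.div_eq_of_lt this]
    · apply Fin.ext
      simp [Nat.mod_eq_of_lt this]


/-! ### Reduction from arbitrary random tapes to finite seeds -/

section Discretization

theorem sum_measureReal_preimage {Ω S : Type} [MeasurableSpace Ω] [Fintype S] (μ : Measure Ω)
    [IsFiniteMeasure μ] {φ : Ω → S} (hφ : ∀ σ, MeasurableSet (φ ⁻¹' {σ})) (A : Set S) :
    ∑ σ, μ.real (φ ⁻¹' {σ}) * A.indicator 1 σ = μ.real (φ ⁻¹' A) := by
  classical
  have hA : φ ⁻¹' A = ⋃ σ ∈ Finset.univ.filter (· ∈ A), φ ⁻¹' {σ} := by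
    ext ω
    simp
  rw [hA, measureReal_biUnion_finset]
  · rw [Finset.sum_filter]
    refine Finset.sum_congr rfl fun σ _ => ?_
    by_cases h : σ ∈ A <;> simp [h]
  · intro σ _ τ _ hne
    refine Set.disjoint_left.2 fun ω h1 h2 => hne ?_
    exact (Set.mem_singleton_iff.1 h1).symm.trans (Set.mem_singleton_iff.1 h2)
  · exact fun σ _ => hφ σ

theorem pi_real_preimage {V Ω S : Type} [Fintype V] [DecidableEq V] [MeasurableSpace Ω] [Fintype S]
    (μ : Measure Ω) [IsProbabilityMeasure μ] {φ : Ω → S} (hφ : ∀ σ, MeasurableSet (φ ⁻¹' {σ}))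
    (E : Set (V → S)) :
    (Measure.pi fun _ : V => μ).real {s | (fun v => φ (s v)) ∈ E} =
      iidProb (fun σ => μ.real (φ ⁻¹' {σ})) E := by
  have hpre : ∀ t : V → S, (fun (s : V → Ω) v => φ (s v)) ⁻¹' {t} =
      Set.univ.pi fun v => φ ⁻¹' {t v} := by
    intro t
    ext s
    simp [funext_iff]
  have := sum_measureReal_preimage (Measure.pi fun _ : V => μ)
    (φ := fun (s : V → Ω) v => φ (s v)) (fun t => by
      rw [hpre]
      exact MeasurableSet.univ_pi fun v => hφ _) E
  refine this.symm.trans (Finset.sum_congr rfl fun t _ => ?_)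
  congr 1
  rw [hpre, measureReal_def, Measure.pi_pi, ENNReal.toReal_prod]
  rfl

instance finite_packet (model : Model) : Finite model.Packet := by
  cases model with
  | radioCD p => exact inferInstanceAs (Finite (Fin p → Bool))
  | beep => exact inferInstanceAs (Finite Unit)

instance finite_obs {M : Type} [Finite M] : Finite (Obs M) := by
  let f : M ⊕ Fin 4 → Obs M := Sum.elim Obs.packet ![.own, .silence, .collision, .beep]
  refine Finite.of_surjective f fun o => ?_
  cases o with
  | own => exact ⟨Sum.inr 0, rfl⟩
  | silence => exact ⟨Sum.inr 1, rfl⟩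
  | packet m => exact ⟨Sum.inl m, rfl⟩
  | collision => exact ⟨Sum.inr 2, rfl⟩
  | beep => exact ⟨Sum.inr 3, rfl⟩

instance isProbabilityMeasure_idLaw (b : ℕ) : IsProbabilityMeasure (idLaw b) := by
  unfold idLaw
  infer_instance

theorem idLaw_real_singleton {b : ℕ} (x : ID b) : (idLaw b).real {x} = ((2 : ℝ) ^ b)⁻¹ := by
  unfold idLaw
  rw [measureReal_def, PMF.toMeasure_apply_singleton _ _ (MeasurableSet.singleton x)]
  simp

/-- Lists of at most `T` observations. -/
abbrev ShortHistory (model : Model) (T : ℕ) : Type :=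
  {l : List (Obs model.Packet) // l.length ≤ T}

instance finite_shortHistory (model : Model) (T : ℕ) : Finite (ShortHistory model T) :=
  (List.finite_length_le (Obs model.Packet) T).to_subtype

/-- An identifier together with the actions and the outputs during the first `T` rounds. -/
abbrev FiniteSeed (model : Model) (b T : ℕ) : Type :=
  ID b × (ShortHistory model T → Option model.Packet × Option (ID b))

variable {model : Model} {b : ℕ}

/-- The part of a node's identifier and tape that matters during the first `T` rounds. -/
def Protocol.finiteSeed (P : Protocol model b) (T : ℕ) (x : ID b × P.Tape) :
    FiniteSeed model b T :=
  (x.1, fun l => (P.act x.1 x.2 l, P.out x.1 x.2 l))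

theorem measurableSet_finiteSeed_preimage (P : Protocol model b) (T : ℕ)
    (σ : FiniteSeed model b T) : MeasurableSet (P.finiteSeed T ⁻¹' {σ}) := by
  have h : P.finiteSeed T ⁻¹' {σ} = {σ.1} ×ˢ ⋂ l : ShortHistory model T,
      {ω | P.act σ.1 ω l = (σ.2 l).1} ∩ {ω | P.out σ.1 ω l = (σ.2 l).2} := by
    ext ⟨i, ω⟩
    simp only [Set.mem_preimage, Set.mem_singleton_iff, Protocol.finiteSeed, Set.mem_prod,
      Set.mem_iInter, Set.mem_inter_iff, Set.mem_ofPred_eq, Prod.ext_iff, funext_iff]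
    constructor
    · rintro ⟨hi, h⟩
      obtain rfl : i = σ.1 := funext hi
      exact ⟨hi, h⟩
    · rintro ⟨hi, h⟩
      obtain rfl : i = σ.1 := funext hi
      exact ⟨hi, h⟩
  rw [h]
  exact (MeasurableSet.singleton _).prod (MeasurableSet.iInter fun l =>
    (P.measurable_act _ _ _).inter (P.measurable_out _ _ _))

/-- The actions prescribed by a finite seed. -/
def FiniteSeed.act {T : ℕ} (σ : FiniteSeed model b T) (l : List (Obs model.Packet)) :
    Option model.Packet :=
  if h : l.length ≤ T then (σ.2 ⟨l, h⟩).1 else none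

/-- The outputs prescribed by a finite seed. -/
def FiniteSeed.out {T : ℕ} (σ : FiniteSeed model b T) (l : List (Obs model.Packet)) :
    Option (ID b) :=
  if h : l.length ≤ T then (σ.2 ⟨l, h⟩).2 else none

/-- During `T` rounds only histories of length at most `T` occur, so the default `none` of a finite
seed is never consulted. -/
theorem elects_iff_seedsElect {V : Type} (P : Protocol model b) (G : SimpleGraph V) (T : ℕ)
    (s : V → ID b × P.Tape) : P.Elects G Set.univ T s ↔
      SeedsElect G Prod.fst FiniteSeed.act FiniteSeed.out T fun v => P.finiteSeed T (s v) := by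
  have hrun : ∀ v, run G (fun u => P.act (s u).1 (s u).2) T v =
      run G (fun u => FiniteSeed.act (P.finiteSeed T (s u))) T v :=
    run_congr_of_short (fun v l hl => by simp [FiniteSeed.act, Protocol.finiteSeed, hl]) T le_rfl
  have hout : ∀ v, P.output G Set.univ s T v = FiniteSeed.out (P.finiteSeed T (s v))
      (run G (fun u => FiniteSeed.act (P.finiteSeed T (s u))) T v) := by
    intro v
    rw [Protocol.output, view_univ, hrun v]
    simp [FiniteSeed.out, Protocol.finiteSeed, length_run]
  unfold Protocol.Elects SeedsElect
  simp only [hout]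
  rfl

end Discretization

/-! ### Uniqueness forces long identifiers -/

section UniqueIDs

theorem descFactorial_succ_le (N m : ℕ) : N.descFactorial (m + 1) ≤ N * (N - 1) ^ m := by
  induction m with
  | zero => simp
  | succ m ih =>
    rw [Nat.descFactorial_succ, pow_succ]
    calc (N - (m + 1)) * N.descFactorial (m + 1) ≤ (N - 1) * (N * (N - 1) ^ m) :=
          Nat.mul_le_mul (by omega) ih
      _ = N * ((N - 1) ^ m * (N - 1)) := by ring

theorem injective_real_eq (n b : ℕ) :
    (Measure.pi fun _ : Fin n => idLaw b).real {ids | Function.Injective ids} =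
      ((2 ^ b).descFactorial n : ℝ) / (2 ^ b : ℝ) ^ n := by
  classical
  have h := pi_real_preimage (V := Fin n) (idLaw b) (φ := id)
    (fun σ => MeasurableSet.singleton σ) {ids | Function.Injective ids}
  refine h.trans ?_
  have hcard : (Finset.univ.filter fun f : Fin n → ID b => Function.Injective f).card =
      (2 ^ b).descFactorial n := by
    rw [← Fintype.card_subtype, Fintype.card_congr (Equiv.subtypeInjectiveEquivEmbedding _ _),
      Fintype.card_embedding_eq]
    simp
  unfold iidProb iidExp
  simp only [Set.preimage_id, idLaw_real_singleton, Finset.prod_const, Finset.card_univ,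
    Fintype.card_fin, ← Finset.mul_sum]
  rw [← hcard, Finset.card_filter, div_eq_mul_inv, mul_comm, inv_pow]
  push_cast
  congr 1
  exact Finset.sum_congr rfl fun f _ => by simp [Set.indicator_apply]

/-- Bernoulli's inequality for `(1 + N⁻¹) ^ m`, combined with `(1 - N⁻¹) * (1 + N⁻¹) ≤ 1`. -/
theorem one_sub_inv_pow_le {N : ℝ} (hN : 1 ≤ N) (m : ℕ) :
    (1 - N⁻¹) ^ m * (N + m) ≤ N := by
  have h0 : 0 < N := by linarith
  have hi : N⁻¹ ≤ 1 := inv_le_one_of_one_le₀ hN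
  have hi0 : 0 < N⁻¹ := inv_pos.2 h0
  have h1 : 1 + m * N⁻¹ ≤ (1 + N⁻¹) ^ m := one_add_mul_le_pow (by linarith) m
  have h2 : (1 - N⁻¹) ^ m * (1 + N⁻¹) ^ m ≤ 1 := by
    rw [← mul_pow]
    exact pow_le_one₀ (mul_nonneg (by linarith) (by linarith)) (by nlinarith)
  have h3 : (1 - N⁻¹) ^ m * (1 + m * N⁻¹) ≤ 1 :=
    (mul_le_mul_of_nonneg_left h1 (pow_nonneg (by linarith) m)).trans h2
  calc (1 - N⁻¹) ^ m * (N + m) = N * ((1 - N⁻¹) ^ m * (1 + m * N⁻¹)) := by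
        field_simp
    _ ≤ N * 1 := mul_le_mul_of_nonneg_left h3 h0.le
    _ = N := mul_one N

/-- Bounding every factor after the first by `1 - N⁻¹` suffices: a bound linear in `n / N` is all
that the guessing argument needs. -/
theorem mul_inv_two_pow_le_of_unique {n b : ℕ} {c : ℝ} (hn : 2 ≤ n) (hc : 2 ≤ (n : ℝ) ^ c)
    (h : IDsUniqueWHP n b c) : (n : ℝ) * ((2 : ℝ) ^ b)⁻¹ ≤ 4 * (n : ℝ) ^ (-c) := by
  obtain ⟨m, rfl⟩ : ∃ m, n = m + 1 := ⟨n - 1, by omega⟩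
  have hm : 1 ≤ m := by omega
  have hm' : (1 : ℝ) ≤ m := by exact_mod_cast hm
  unfold IDsUniqueWHP at h
  rw [injective_real_eq] at h
  set L : ℝ := ((m + 1 : ℕ) : ℝ) ^ c with hL
  have hneg : ((m + 1 : ℕ) : ℝ) ^ (-c) = L⁻¹ := Real.rpow_neg (by positivity) c
  rw [hneg] at h ⊢
  set N : ℝ := (2 : ℝ) ^ b with hN
  have hN1 : 1 ≤ N := one_le_pow₀ (by norm_num)
  have hN0 : 0 < N := by linarith
  have hdesc : (((2 ^ b).descFactorial (m + 1) : ℕ) : ℝ) ≤ N * (N - 1) ^ m := by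
    have := descFactorial_succ_le (2 ^ b) m
    have h' : (((2 ^ b).descFactorial (m + 1) : ℕ) : ℝ) ≤
        ((2 ^ b * (2 ^ b - 1) ^ m : ℕ) : ℝ) := by exact_mod_cast this
    rw [Nat.cast_mul, Nat.cast_pow (2 ^ b - 1), Nat.cast_sub Nat.one_le_two_pow] at h'
    simpa [hN] using h'
  have hle : 1 - L⁻¹ ≤ (1 - N⁻¹) ^ m := by
    refine h.trans ?_
    rw [div_le_iff₀ (by positivity)]
    refine hdesc.trans (le_of_eq ?_)
    rw [pow_succ, ← mul_assoc, ← mul_pow, sub_mul, inv_mul_cancel₀ hN0.ne', one_mul, mul_comm]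
  have h1 : (1 - L⁻¹) * (N + m) ≤ N :=
    (mul_le_mul_of_nonneg_right hle (by positivity)).trans (one_sub_inv_pow_le hN1 m)
  have hL0 : 0 < L := by linarith
  have h2 : (L - 1) * m ≤ N := by
    have : (1 - L⁻¹) * (N + m) * L ≤ N * L := mul_le_mul_of_nonneg_right h1 hL0.le
    have e : (1 - L⁻¹) * (N + m) * L = (L - 1) * (N + m) := by
      field_simp
    rw [e] at this
    linarith
  -- The factor `4` comes from `m + 1 ≤ 2 * m` and `L ≤ 2 * (L - 1)`.
  rw [← div_eq_mul_inv, ← div_eq_mul_inv, div_le_div_iff₀ hN0 hL0]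
  push_cast
  nlinarith

end UniqueIDs


/-! ### The two lower bounds for protocols -/

section LowerBounds

variable {model : Model} {wake : WakeUp} {n D b T : ℕ} {c : ℝ}

theorem one_sub_le_iidProb_hard [Fintype (FiniteSeed model b T)] (hD : 1 ≤ D) (hDn : D < n)
    (P : Protocol model b) (h : P.SolvesLeaderElection wake n D T c) :
    1 - (n : ℝ) ^ (-c) ≤
      iidProb (fun σ => ((idLaw b).prod P.law).real (P.finiteSeed T ⁻¹' {σ}))
        {s | SeedsElect (layeredGraph (hardLayer n D)) Prod.fst FiniteSeed.act FiniteSeed.out T s} := by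
  -- Waking all nodes is allowed in both modes, so one argument covers both.
  have hW : wake.Allows (Set.univ : Set (Fin n)) := by
    cases wake with
    | synchronous => rfl
    | arbitrary => exact ⟨⟨0, by omega⟩, trivial⟩
  refine (h _ (layeredGraph_connected hD (hardLayer_le hD) (exists_hardLayer_eq hDn))
    (layeredGraph_diam hD (hardLayer_le hD) (exists_hardLayer_eq hDn)) Set.univ hW).trans
    (le_of_eq ?_)
  rw [← pi_real_preimage ((idLaw b).prod P.law) (measurableSet_finiteSeed_preimage P T)]
  unfold Protocol.seedLaw
  congr 1
  ext s
  exact elects_iff_seedsElect P _ T s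

theorem sum_finiteSeed_weight [Fintype (FiniteSeed model b T)] (P : Protocol model b) :
    ∑ σ, ((idLaw b).prod P.law).real (P.finiteSeed T ⁻¹' {σ}) = 1 := by
  have := sum_measureReal_preimage ((idLaw b).prod P.law)
    (measurableSet_finiteSeed_preimage P T) Set.univ
  simpa using this

theorem sum_finiteSeed_weight_id [Fintype (FiniteSeed model b T)] (P : Protocol model b)
    (x : ID b) : ∑ σ, ((idLaw b).prod P.law).real (P.finiteSeed T ⁻¹' {σ}) *
      ((Prod.fst : FiniteSeed model b T → ID b) ⁻¹' {x}).indicator 1 σ = ((2 : ℝ) ^ b)⁻¹ := by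
  rw [sum_measureReal_preimage ((idLaw b).prod P.law) (measurableSet_finiteSeed_preimage P T)]
  have hset : P.finiteSeed T ⁻¹' ((Prod.fst : FiniteSeed model b T → ID b) ⁻¹' {x}) =
      {x} ×ˢ Set.univ := by
    ext ⟨i, ω⟩
    simp [Protocol.finiteSeed]
  rw [hset, measureReal_prod_prod, idLaw_real_singleton]
  simp

theorem diameter_le_two_mul (hD : 1 ≤ D) (hDn : D < n) (hL : 25 ≤ (n : ℝ) ^ c)
    (hid : IDsUniqueWHP n b c) (P : Protocol model b) (h : P.SolvesLeaderElection wake n D T c) :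
    D ≤ 2 * T := by
  classical
  let _ : Fintype (FiniteSeed model b T) := Fintype.ofFinite _
  by_contra hT
  have h1 := one_sub_le_iidProb_hard hD hDn P h
  obtain ⟨u, hu⟩ := exists_hardLayer_eq hDn 0 (Nat.zero_le _)
  obtain ⟨v, hv⟩ := exists_hardLayer_eq hDn D le_rfl
  have h2 := iidProb_elect_le_of_far (T := T) (act := FiniteSeed.act) (out := FiniteSeed.out)
    (fun σ => measureReal_nonneg) (sum_finiteSeed_weight (T := T) P)
    (fun x => (sum_finiteSeed_weight_id (T := T) P x).le) (by positivity) hu hv (by omega)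
  have h3 := mul_inv_two_pow_le_of_unique (by omega) (by linarith) hid
  rw [Fintype.card_fin] at h2
  have h4 : (n : ℝ) ^ (-c) ≤ 25⁻¹ := by
    rw [Real.rpow_neg (by positivity)]
    exact inv_anti₀ (by norm_num) hL
  linarith

theorem rpow_le_of_solves (hD : 1 ≤ D) (hDn : D + 7 ≤ n) (hL : 25 ≤ (n : ℝ) ^ c)
    (hid : IDsUniqueWHP n b c) (P : Protocol model b) (h : P.SolvesLeaderElection wake n D T c) :
    (n : ℝ) ^ c ≤ 5 * 32 ^ T := by
  classical
  let _ : Fintype (FiniteSeed model b T) := Fintype.ofFinite _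
  have h1 := one_sub_le_iidProb_hard hD (by omega) P h
  let u : Fin n := ⟨0, by omega⟩
  let v : Fin n := ⟨2, by omega⟩
  have hu : hardLayer n D u = 0 := by
    unfold hardLayer
    rw [if_pos (by simp only [u]; omega)]
    rfl
  have hv : hardLayer n D v = 0 := by
    unfold hardLayer
    rw [if_pos (by simp only [v]; omega)]
    simp [v]
  have huv : u ≠ v := by simp [u, v]
  have h2 := iidProb_elect_le_of_uninformed (T := T) (act := FiniteSeed.act)
    (out := FiniteSeed.out) (G := layeredGraph (hardLayer n D))
    (fun σ => measureReal_nonneg) (sum_finiteSeed_weight (T := T) P)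
    (fun x => (sum_finiteSeed_weight_id (T := T) P x).le) (by positivity) huv
  have hF : ((16 : ℝ) ^ T)⁻¹ ≤
      iidProb (fun σ => ((idLaw b).prod P.law).real (P.finiteSeed T ⁻¹' {σ}))
        {s | Uninformed (layeredGraph (hardLayer n D)) FiniteSeed.act T u s ∧
          Uninformed (layeredGraph (hardLayer n D)) FiniteSeed.act T v s} := by
    cases model with
    | radioCD packetBits =>
      -- With `m = n + 1 - D ≥ 8`, this `q` is even and satisfies `2 * q ≤ m ≤ 3 * q`; the last
      -- inequality can fail for smaller `m`.
      exact iidProb_uninformed_radio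
        (coreCopies_hardCopy (q := 2 * ((n + 1 - D) / 4)) (by omega) (by omega)
          (Dvd.intro _ rfl) (by omega) hD)
        (fun σ => measureReal_nonneg) (sum_finiteSeed_weight (T := T) P) _ hu hv
    | beep =>
      have huniv : {s | Uninformed (layeredGraph (hardLayer n D)) FiniteSeed.act T u s ∧
          Uninformed (layeredGraph (hardLayer n D)) FiniteSeed.act T v s} =
          (∅ : Set (Fin n → FiniteSeed Model.beep b T))ᶜ := by
        rw [Set.compl_empty, Set.eq_univ_iff_forall]
        exact fun s => ⟨uninformed_of_beep _ _ _ _, uninformed_of_beep _ _ _ _⟩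
      rw [huniv, iidProb_compl (sum_finiteSeed_weight (T := T) P)]
      have h0 : iidProb (fun σ => ((idLaw b).prod P.law).real (P.finiteSeed T ⁻¹' {σ}))
          (∅ : Set (Fin n → FiniteSeed Model.beep b T)) = 0 := by
        simp [iidProb, iidExp]
      rw [h0, sub_zero]
      exact inv_le_one_of_one_le₀ (one_le_pow₀ (by norm_num))
  have h3 := mul_inv_two_pow_le_of_unique (by omega) (by linarith) hid
  rw [Fintype.card_fin] at h2
  have hL0 : 0 < (n : ℝ) ^ c := by linarith
  rw [Real.rpow_neg (by positivity)] at h1 h3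
  have h2T : (1 : ℝ) ≤ 2 ^ T := one_le_pow₀ (by norm_num)
  have hLi : 0 < ((n : ℝ) ^ c)⁻¹ := inv_pos.2 hL0
  have h4 : ((16 : ℝ) ^ T)⁻¹ ≤ 5 * 2 ^ T * ((n : ℝ) ^ c)⁻¹ := by
    have h5 : (n : ℝ) * (2 ^ T * ((2 : ℝ) ^ b)⁻¹) ≤ 2 ^ T * (4 * ((n : ℝ) ^ c)⁻¹) := by
      calc (n : ℝ) * (2 ^ T * ((2 : ℝ) ^ b)⁻¹) = 2 ^ T * (n * ((2 : ℝ) ^ b)⁻¹) := by ring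
        _ ≤ _ := mul_le_mul_of_nonneg_left h3 (by positivity)
    have h6 : ((n : ℝ) ^ c)⁻¹ ≤ 2 ^ T * ((n : ℝ) ^ c)⁻¹ := le_mul_of_one_le_left hLi.le h2T
    linarith
  rw [← div_eq_mul_inv, le_div_iff₀ hL0, inv_mul_le_iff₀ (by positivity)] at h4
  calc (n : ℝ) ^ c ≤ 16 ^ T * (5 * 2 ^ T) := h4
    _ = 5 * (16 * 2) ^ T := by rw [mul_pow]; ring
    _ = 5 * 32 ^ T := by norm_num

/-- As `25 = 5 ^ 2`, the term `log 5` is at most half of `c * log n`; the other half is at most `T *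
log 32 ≤ 4 * T`. -/
theorem log_le_of_rpow_le (hn : 1 ≤ n) (hL : 25 ≤ (n : ℝ) ^ c)
    (h : (n : ℝ) ^ c ≤ 5 * 32 ^ T) : c / 8 * Real.log n ≤ T := by
  have hn0 : (0 : ℝ) < n := by exact_mod_cast hn
  have h1 : Real.log 25 ≤ c * Real.log n := by
    rw [← Real.log_rpow hn0]
    exact Real.log_le_log (by norm_num) hL
  have h2 : c * Real.log n ≤ Real.log 5 + T * Real.log 32 := by
    rw [← Real.log_rpow hn0, ← Real.log_pow, ← Real.log_mul (by norm_num) (by positivity)]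
    exact Real.log_le_log (by linarith) h
  have h25 : Real.log 25 = 2 * Real.log 5 := by
    rw [show (25 : ℝ) = 5 ^ 2 by norm_num, Real.log_pow]
    norm_num
  have h32 : Real.log 32 ≤ 4 := by
    rw [show (32 : ℝ) = 2 ^ 5 by norm_num, Real.log_pow]
    have := Real.log_two_lt_d9
    norm_num
    linarith
  have hT : (T : ℝ) * Real.log 32 ≤ T * 4 :=
    mul_le_mul_of_nonneg_left h32 (Nat.cast_nonneg T)
  linarith

end LowerBounds

end RadioNetwork

theorem mainTheorem7 (c : ℝ) (hc : 0 < c) :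
    ∃ κ : ℝ, 0 < κ ∧ ∃ n₀ : ℕ,
      ∀ (model : RadioNetwork.Model) (wake : RadioNetwork.WakeUp) (n D b T : ℕ),
        n₀ ≤ n → 1 ≤ D → D < n → RadioNetwork.IDsUniqueWHP n b c →
        ∀ P : RadioNetwork.Protocol model b, P.SolvesLeaderElection wake n D T c →
          κ * ((D : ℝ) + Real.log n) ≤ (T : ℝ) := by
  have htend : Filter.Tendsto (fun n : ℕ => (n : ℝ) ^ c) Filter.atTop Filter.atTop :=
    (tendsto_rpow_atTop hc).comp tendsto_natCast_atTop_atTop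
  obtain ⟨n₀, hn₀⟩ := Filter.eventually_atTop.1 (htend.eventually_ge_atTop 25)
  refine ⟨min (c / 8) (1 / 4) / 2, by positivity, max n₀ 16, ?_⟩
  intro model wake n D b T hn hD hDn hid P h
  have hL := hn₀ n (by omega)
  have hn16 : 16 ≤ n := by omega
  have hlog0 : 0 ≤ Real.log n := Real.log_natCast_nonneg n
  have hT := RadioNetwork.diameter_le_two_mul hD hDn hL hid P h
  have hTr : (D : ℝ) ≤ 2 * T := by exact_mod_cast hT
  have hlog : min (c / 8) (1 / 4) * Real.log n ≤ T := by
    -- For `2 * D ≤ n` and `16 ≤ n` the core is large enough for the three copies. Otherwise `n < 2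
    -- * D ≤ 4 * T`, and the diameter bound alone exceeds the logarithm.
    by_cases hsmall : 2 * D ≤ n
    · exact (mul_le_mul_of_nonneg_right (min_le_left _ _) hlog0).trans
        (RadioNetwork.log_le_of_rpow_le (by omega) hL
          (RadioNetwork.rpow_le_of_solves hD (by omega) hL hid P h))
    · have h1 : Real.log n ≤ n := Real.log_le_self (Nat.cast_nonneg n)
      have h2 : (n : ℝ) ≤ 4 * T := by
        exact_mod_cast (by omega : n ≤ 4 * T)
      have h3 := mul_le_mul_of_nonneg_right (min_le_right (c / 8) (1 / 4)) hlog0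
      linarith
  have hD' : min (c / 8) (1 / 4) * (D : ℝ) ≤ T := by
    have h3 := mul_le_mul_of_nonneg_right (min_le_right (c / 8) (1 / 4)) (Nat.cast_nonneg (α := ℝ) D)
    have : (0 : ℝ) ≤ T := Nat.cast_nonneg T
    linarith
  linarith
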